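/- Identify $\mathbb{R}^2$ with $\mathbb{C}$. For a function $K_0:(0,\infty)\to\mathbb{R}$ consider the conditions (A1) $K_0$ is differentiable and $-K_0'$ is a nonzero completely monotone function, i.e. $-K_0'\in C^\infty((0,\infty))$, $-K_0'\not\equiv 0$ and $(-1)^n\frac{d^n}{dt^n}(-K_0')(t)\ge 0$ for all $t>0$ and all integers $n\ge 0$; (A2) there is $\alpha\in(0,1)$ with $\int_0^1|K_0(t)|\,t^{-\alpha+\alpha^2}\,dt<\infty$. Let $K(\mathbf x,\mathbf y)=K_0(|\mathbf x-\mathbf y|)$ be the associated convolution kernel and, for $b\in(0,1)$ and $\theta\in\mathbb{R}$, set $$V_b^1[\mathbf 0](\theta)=\frac1b\int_0^{2\pi}\!\!\int_b^1\big(\nabla_{\mathbf x}K(be^{i\theta},\rho e^{i\eta})\cdot e^{i\theta}\big)\rho\,d\rho\,d\eta,\qquad V_b^2[\mathbf 0](\theta)=\int_0^{2\pi}\!\!\int_b^1\big(\nabla_{\mathbf x}K(e^{i\theta},\rho e^{i\eta})\cdot e^{i\theta}\big)\rho\,d\rho\,d\eta$$ (these do not depend on $\theta$). For a set $S\subset(0,\infty)$,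 a function $f:S\to(0,\infty)$ and $C_0\in\mathbb{R}$ let $$K_0(t)=\int_t^1\int_0^\infty e^{-\tau x}f(x)\mathbf 1_S(x)\,dx\,d\tau+C_0,\qquad t>0,\tag{$*$}$$ that is, up to the additive constant, $-K_0'(t)=\int_{[0,\infty)} e^{-tx}\,d\mu(x)$ for all $t>0$ with $d\mu=f\mathbf 1_S\,dx$. **Proposition.** (i) There exist $b_*\in(0,1)$ and $x_*>0$ such that, for every positive integrable function $f:(0,x_*)\to(0,\infty)$ and every $C_0\in\mathbb{R}$, the kernel $(*)$ with $S=(0,x_*)$ has $-K_0'$ equal to the Laplace transform of the nonzero measure $d\mu=f\mathbf 1_{(0,x_*)}dx$, satisfies (A1) and (A2), and $$V_b^1[\mathbf 0](\theta)<V_b^2[\mathbf 0](\theta)<0\qquad\text{for all } b\in(0,b_*),\ \theta\in\mathbb{R}.$$ (ii) For every $b\in(0,1)$ there exists $x^*=x^*(b)>0$ such that, for every measurable positive function $f:(x^*,\infty)\to(0,\infty)$ for which there are $C\in\mathbb{R}$ and $\gamma>0$ with $f(x)\le Cx^{1-\gamma}$ for all $x>x^*$, and every $C_0\in\mathbb{R}$,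 the kernel $(*)$ with $S=(x^*,\infty)$ has $-K_0'$ equal to the Laplace transform of the nonzero measure $d\mu=f\mathbf 1_{(x^*,\infty)}dx$, satisfies (A1) and (A2), and $$V_b^2[\mathbf 0](\theta)<0<V_b^1[\mathbf 0](\theta)\qquad\text{for all } \theta\in\mathbb{R}.$$ -/

import Mathlib

open MeasureTheory Set
open scoped ContDiff

noncomputable section

/-- A function on `(0, ∞)` (values outside `(0, ∞)` are irrelevant) is completely monotone if it
is smooth and `(-1)^n f^(n) ≥ 0` on `(0, ∞)` for all `n`. -/
def CompletelyMonotone (f : ℝ → ℝ) : Prop :=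
  ContDiffOn ℝ ∞ f (Ioi 0) ∧ ∀ (n : ℕ) (t : ℝ), 0 < t → 0 ≤ (-1 : ℝ) ^ n * iteratedDeriv n f t

/-- Assumption (A1): `K₀` is differentiable on `(0, ∞)`, and `-K₀'` is a nonzero completely
monotone function on `(0, ∞)`. -/
def AssumptionA1 (K₀ : ℝ → ℝ) : Prop :=
  (∀ t : ℝ, 0 < t → DifferentiableAt ℝ K₀ t) ∧
    CompletelyMonotone (fun t => -deriv K₀ t) ∧
    ∃ t : ℝ, 0 < t ∧ -deriv K₀ t ≠ 0

/-- Assumption (A2): `∫₀¹ |K₀(t)| t^(-α + α²) dt < ∞` for some `α ∈ (0, 1)`. -/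
def AssumptionA2 (K₀ : ℝ → ℝ) : Prop :=
  ∃ α : ℝ, α ∈ Ioo (0 : ℝ) 1 ∧
    IntegrableOn (fun t : ℝ => |K₀ t| * t ^ (-α + α ^ 2)) (Ioo 0 1) volume

/-- `μ` is a nonzero measure on `[0, ∞)` with `-K₀'(t) = ∫_{[0,∞)} e^(-t x) dμ(x)` for `t > 0`. -/
def IsRepresentingMeasure (K₀ : ℝ → ℝ) (μ : Measure ℝ) : Prop :=
  μ (Iio 0) = 0 ∧ μ ≠ 0 ∧
    ∀ t : ℝ, 0 < t →
      IntegrableOn (fun x : ℝ => Real.exp (-t * x)) (Ici 0) μ ∧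
        HasDerivAt K₀ (-∫ x in Ici (0 : ℝ), Real.exp (-t * x) ∂μ) t

/-- The measure `f 1_S dx`. -/
def densityMeasure (S : Set ℝ) (f : ℝ → ℝ) : Measure ℝ :=
  (volume.restrict S).withDensity (fun x => ENNReal.ofReal (f x))

/-- `K₀(t) = ∫_t^1 ∫_0^∞ e^(-τ x) f(x) 1_S(x) dx dτ + C₀`, for `t > 0`. -/
def densityKernel (S : Set ℝ) (f : ℝ → ℝ) (C₀ : ℝ) (t : ℝ) : ℝ :=
  (∫ τ in t..1, ∫ x in Ioi (0 : ℝ), Real.exp (-τ * x) * S.indicator f x) + C₀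

/-- The convolution kernel `K(x, y) = K₀(|x - y|)` on the plane, identified with `ℂ`. -/
def convolutionKernel (K₀ : ℝ → ℝ) (x y : ℂ) : ℝ := K₀ ‖x - y‖

/-- The point `e^{iθ}`. -/
def circlePoint (θ : ℝ) : ℂ := Complex.exp (θ * Complex.I)

/-- Polar radius `R₁(θ) = √(b² + 2 r₁(θ))` of the inner boundary. -/
def innerRadius (b : ℝ) (r₁ : ℝ → ℝ) (θ : ℝ) : ℝ := Real.sqrt (b ^ 2 + 2 * r₁ θ)

/-- Polar radius `R₂(θ) = √(1 + 2 r₂(θ))` of the outer boundary. -/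
def outerRadius (r₂ : ℝ → ℝ) (θ : ℝ) : ℝ := Real.sqrt (1 + 2 * r₂ θ)

/-- `∫_0^{2π} ∫_{R₁(η)}^{R₂(η)} (∇_x K(x, ρ e^{iη}) · v) ρ dρ dη`; the inner product of the
gradient with `v` is written as the derivative in the direction `v`. -/
def patchGradient (K : ℂ → ℂ → ℝ) (R₁ R₂ : ℝ → ℝ) (x v : ℂ) : ℝ :=
  ∫ η in (0 : ℝ)..(2 * Real.pi), ∫ ρ in (R₁ η)..(R₂ η),
    fderiv ℝ (fun z : ℂ => K z (ρ * circlePoint η)) x v * ρ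

/-- `V_b^1[r](θ)`, for `r = (r₁, r₂)`. -/
def V1 (K : ℂ → ℂ → ℝ) (b : ℝ) (r₁ r₂ : ℝ → ℝ) (θ : ℝ) : ℝ :=
  (1 / innerRadius b r₁ θ) *
    patchGradient K (innerRadius b r₁) (outerRadius r₂)
      (innerRadius b r₁ θ * circlePoint θ) (circlePoint θ)

/-- `V_b^2[r](θ)`, for `r = (r₁, r₂)`. -/
def V2 (K : ℂ → ℂ → ℝ) (b : ℝ) (r₁ r₂ : ℝ → ℝ) (θ : ℝ) : ℝ :=
  (1 / outerRadius r₂ θ) *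
    patchGradient K (innerRadius b r₁) (outerRadius r₂)
      (outerRadius r₂ θ * circlePoint θ) (circlePoint θ)

end

/-! Since `-K₀'` is a superposition of exponentials `e^{-xt}` with weight `f`, Fubini turns both
velocities into averages over `x`: `V1 = -∫ f(x) F(b, x) / b` and `V2 = -∫ f(x) G(b, x)`. Here `F =
annulusForce b b` and `G = annulusForce b 1` integrate `e^{-x|r-y|} cos(angle)` over the annulus for
`r = b` and `r = 1` (`V1_densityKernel`, `V2_densityKernel`). Each sign claim then follows from a
strict inequality at every `x` in the support of `f`. `AdmissibleDensity` collects what both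
families of densities share and what Fubini, (A1) and (A2) require.

Outer boundary: the whole annulus lies to the left of the point 1, so `G > 0` always.

Small `x`: as `x → 0` the exponential disappears. The inner force at `x = 0`, divided by `b`, tends
to `π` as `b → 0` (`tendsto_annulusForce_div`), while `G` is at most the integral of a cosine over
the unit disc, which is strictly less than `π`. A Lipschitz estimate shows that replacing `x = 0` by
small `x` costs `O(x)` in `F / b`, uniformly in `b`, hence `G < F / b`.

Large `x`: the exponential concentrates the force at scale `1/x` around the inner boundary point
`b`. There the annulus fills nearly a half plane to the right, which pulls `F` to the negative side
at order `x^{-2}`. The curvature of the inner circle adds only a correction of order `x^{-3}`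
(`exists_annulusForce_neg`). -/

open scoped Topology

/-! ### Laplace transforms of admissible densities; (A1) and (A2) -/

/-- A positive density on `S ⊆ (0, ∞)` whose Laplace transform is finite on `(0, ∞)` and is
`O(t ^ (γ - 2))` on `(0, 2]`. -/
structure AdmissibleDensity (S : Set ℝ) (f : ℝ → ℝ) : Prop where
  measurableSet : MeasurableSet S
  subset_Ioi : S ⊆ Ioi 0
  volume_ne_zero : volume S ≠ 0
  aemeasurable : AEMeasurable f (volume.restrict S)
  pos : ∀ x ∈ S, 0 < f x
  integrableOn : ∀ t : ℝ, 0 < t → IntegrableOn (fun x => f x * Real.exp (-t * x)) S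
  bound : ∃ M γ : ℝ, 0 < γ ∧ γ < 1 ∧ ∀ t : ℝ, 0 < t → t ≤ 2 →
    ∫ x in S, f x * Real.exp (-t * x) ≤ M * t ^ (γ - 2)

/-- The Laplace transform of `f 1_S dx`. -/
noncomputable def laplaceDensity (S : Set ℝ) (f : ℝ → ℝ) (t : ℝ) : ℝ :=
  ∫ x in S, f x * Real.exp (-t * x)

namespace AdmissibleDensity

variable {S : Set ℝ} {f : ℝ → ℝ}

lemma integrable_densityMeasure_iff (h : AdmissibleDensity S f) (g : ℝ → ℝ) :
    Integrable g (densityMeasure S f) ↔ IntegrableOn (fun x => f x * g x) S := by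
  rw [densityMeasure, integrable_withDensity_iff_integrable_smul₀' h.aemeasurable.ennreal_ofReal
    (by simp)]
  refine integrableOn_congr_fun (fun x hx => ?_) h.measurableSet
  simp [ENNReal.toReal_ofReal (h.pos x hx).le]

lemma integral_densityMeasure (h : AdmissibleDensity S f) (g : ℝ → ℝ) :
    ∫ x, g x ∂(densityMeasure S f) = ∫ x in S, f x * g x := by
  rw [densityMeasure, integral_withDensity_eq_integral_toReal_smul₀ h.aemeasurable.ennreal_ofReal
    (by simp)]
  refine setIntegral_congr_fun h.measurableSet (fun x hx => ?_)
  simp [ENNReal.toReal_ofReal (h.pos x hx).le]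

lemma ae_mem (h : AdmissibleDensity S f) : ∀ᵐ x ∂(densityMeasure S f), x ∈ S :=
  (withDensity_absolutelyContinuous _ _).ae_le (ae_restrict_mem h.measurableSet)

lemma densityMeasure_restrict_Ici (h : AdmissibleDensity S f) :
    (densityMeasure S f).restrict (Ici 0) = densityMeasure S f :=
  Measure.restrict_eq_self_of_ae_mem (h.ae_mem.mono fun _ hx => Ioi_subset_Ici_self (h.subset_Ioi hx))

lemma setIntegral_pos (h : AdmissibleDensity S f) {g : ℝ → ℝ} (hg : ∀ x ∈ S, 0 < g x)
    (hi : IntegrableOn g S) : 0 < ∫ x in S, g x := by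
  rw [setIntegral_pos_iff_support_of_nonneg_ae
    ((ae_restrict_mem h.measurableSet).mono fun x hx => (hg x hx).le) hi]
  have : Function.support g ∩ S = S :=
    inter_eq_right.2 fun x hx => (hg x hx).ne'
  rw [this]
  exact pos_iff_ne_zero.2 h.volume_ne_zero

lemma laplaceDensity_pos (h : AdmissibleDensity S f) {t : ℝ} (ht : 0 < t) :
    0 < laplaceDensity S f t :=
  h.setIntegral_pos (fun x hx => mul_pos (h.pos x hx) (Real.exp_pos _)) (h.integrableOn t ht)

lemma densityMeasure_ne_zero (h : AdmissibleDensity S f) : densityMeasure S f ≠ 0 := by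
  intro h0
  have h1 := h.laplaceDensity_pos one_pos
  rw [laplaceDensity, ← h.integral_densityMeasure, h0] at h1
  simp at h1

lemma mgf_neg (h : AdmissibleDensity S f) (t : ℝ) :
    ProbabilityTheory.mgf (fun x => -x) (densityMeasure S f) t = laplaceDensity S f t := by
  simp only [ProbabilityTheory.mgf, laplaceDensity, h.integral_densityMeasure, mul_neg, neg_mul]

/-- The Laplace transform is the moment generating function of `x ↦ -x`. Finiteness on all of `(0,
∞)` places every `t > 0` in the interior of its domain, so analyticity and differentiation under the
integral come from the theory of `mgf`. -/
lemma mem_interior (h : AdmissibleDensity S f) {t : ℝ} (ht : 0 < t) :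
    t ∈ interior (ProbabilityTheory.integrableExpSet (fun x => -x) (densityMeasure S f)) := by
  refine interior_mono (s := Ioi 0) (fun s hs => ?_) (by simpa using ht)
  have := (h.integrable_densityMeasure_iff _).2 (h.integrableOn s hs)
  simpa [ProbabilityTheory.integrableExpSet] using this

lemma laplaceDensity_eq_mgf (h : AdmissibleDensity S f) :
    laplaceDensity S f = ProbabilityTheory.mgf (fun x => -x) (densityMeasure S f) :=
  funext fun t => (h.mgf_neg t).symm

lemma analyticAt_laplaceDensity (h : AdmissibleDensity S f) {t : ℝ} (ht : 0 < t) :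
    AnalyticAt ℝ (laplaceDensity S f) t := by
  rw [h.laplaceDensity_eq_mgf]
  exact ProbabilityTheory.analyticAt_mgf (h.mem_interior ht)

lemma continuousOn_laplaceDensity (h : AdmissibleDensity S f) :
    ContinuousOn (laplaceDensity S f) (Ioi 0) :=
  fun _ ht => (h.analyticAt_laplaceDensity ht).continuousAt.continuousWithinAt

lemma completelyMonotone_laplaceDensity (h : AdmissibleDensity S f) :
    CompletelyMonotone (laplaceDensity S f) := by
  refine ⟨fun t ht => ((h.analyticAt_laplaceDensity ht).contDiffAt).contDiffWithinAt,
    fun n t ht => ?_⟩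
  rw [h.laplaceDensity_eq_mgf, ProbabilityTheory.iteratedDeriv_mgf (h.mem_interior ht),
    ← integral_const_mul]
  refine integral_nonneg_of_ae (h.ae_mem.mono fun x hx => ?_)
  have hx0 : 0 < x := h.subset_Ioi hx
  have : (-1 : ℝ) ^ n * ((-x) ^ n * Real.exp (t * -x)) = x ^ n * Real.exp (t * -x) := by
    rw [← mul_assoc, ← mul_pow]; simp
  simp only [Pi.zero_apply, this]
  positivity

lemma densityKernel_eq (h : AdmissibleDensity S f) (C₀ t : ℝ) :
    densityKernel S f C₀ t = (∫ τ in t..1, laplaceDensity S f τ) + C₀ := by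
  rw [densityKernel]
  congr 2
  funext τ
  rw [laplaceDensity]
  have : (fun x => Real.exp (-τ * x) * S.indicator f x)
      = S.indicator (fun x => f x * Real.exp (-τ * x)) := by
    funext x
    by_cases hx : x ∈ S <;> simp [hx, mul_comm]
  rw [this, setIntegral_indicator h.measurableSet, inter_eq_right.2 h.subset_Ioi]

lemma intervalIntegrable_laplaceDensity (h : AdmissibleDensity S f) {s t : ℝ} (hs : 0 < s)
    (ht : 0 < t) : IntervalIntegrable (laplaceDensity S f) volume s t := by
  refine (h.continuousOn_laplaceDensity.mono fun x hx => ?_).intervalIntegrable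
  exact lt_of_lt_of_le (lt_min hs ht) hx.1

lemma hasDerivAt_densityKernel (h : AdmissibleDensity S f) (C₀ : ℝ) {t : ℝ} (ht : 0 < t) :
    HasDerivAt (densityKernel S f C₀) (-laplaceDensity S f t) t := by
  rw [show densityKernel S f C₀ = fun t => (∫ τ in t..1, laplaceDensity S f τ) + C₀ from
    funext fun t => h.densityKernel_eq C₀ t]
  refine (intervalIntegral.integral_hasDerivAt_left
    (h.intervalIntegrable_laplaceDensity ht one_pos) ?_
    (h.analyticAt_laplaceDensity ht).continuousAt).add_const C₀
  exact h.continuousOn_laplaceDensity.stronglyMeasurableAtFilter isOpen_Ioi t ht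

lemma isRepresentingMeasure (h : AdmissibleDensity S f) (C₀ : ℝ) :
    IsRepresentingMeasure (densityKernel S f C₀) (densityMeasure S f) := by
  refine ⟨?_, h.densityMeasure_ne_zero, fun t ht => ⟨?_, ?_⟩⟩
  · refine measure_mono_null (t := Sᶜ) (fun x hx hxS => ?_) (mem_ae_iff.1 h.ae_mem)
    exact lt_asymm (mem_Ioi.1 (h.subset_Ioi hxS)) (mem_Iio.1 hx)
  · rw [IntegrableOn, h.densityMeasure_restrict_Ici, h.integrable_densityMeasure_iff]
    exact h.integrableOn t ht
  · rw [h.densityMeasure_restrict_Ici, h.integral_densityMeasure]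
    exact h.hasDerivAt_densityKernel C₀ ht

lemma assumptionA1 (h : AdmissibleDensity S f) (C₀ : ℝ) :
    AssumptionA1 (densityKernel S f C₀) := by
  have hd : EqOn (fun t => -deriv (densityKernel S f C₀) t) (laplaceDensity S f) (Ioi 0) :=
    fun t ht => by simp [(h.hasDerivAt_densityKernel C₀ ht).deriv]
  refine ⟨fun t ht => (h.hasDerivAt_densityKernel C₀ ht).differentiableAt, ⟨?_, ?_⟩, 1, one_pos, ?_⟩
  · exact h.completelyMonotone_laplaceDensity.1.congr hd
  · intro n t ht
    rw [(hd.eventuallyEq_of_mem (Ioi_mem_nhds ht)).iteratedDeriv_eq n]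
    exact h.completelyMonotone_laplaceDensity.2 n t ht
  · have := hd (mem_Ioi.2 one_pos)
    simp only at this
    rw [this]
    exact (h.laplaceDensity_pos one_pos).ne'

/-- Integrating the bound `M t^(γ-2)` from `t` to 1 gives `|K₀(t)| ≤ K t^(γ-1) + |C₀|`, a
singularity weaker than `1/t`. -/
lemma assumptionA2 (h : AdmissibleDensity S f) (C₀ : ℝ) :
    AssumptionA2 (densityKernel S f C₀) := by
  obtain ⟨M, γ, hγ0, hγ1, hb⟩ := h.bound
  set K := M / (1 - γ) with hK
  have hcont : ContinuousOn (densityKernel S f C₀) (Ioo 0 1) := fun t ht =>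
    (h.hasDerivAt_densityKernel C₀ ht.1).continuousAt.continuousWithinAt
  have hM : 0 ≤ M := by
    have := (h.laplaceDensity_pos one_pos).le.trans (hb 1 one_pos one_le_two)
    simpa using this
  have hKb : ∀ t ∈ Ioo (0 : ℝ) 1, |densityKernel S f C₀ t| ≤ K * t ^ (γ - 1) + |C₀| := by
    intro t ht
    rw [h.densityKernel_eq]
    refine (abs_add_le _ _).trans (add_le_add_left ?_ _)
    rw [abs_of_nonneg (intervalIntegral.integral_nonneg ht.2.le
      fun τ hτ => (h.laplaceDensity_pos (ht.1.trans_le hτ.1)).le)]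
    have h0 : (0 : ℝ) ∉ uIcc t 1 := by
      rw [uIcc_of_le ht.2.le]; exact fun hh => hh.1.not_gt ht.1
    have h1 : ∫ τ in t..1, laplaceDensity S f τ ≤ ∫ τ in t..1, M * τ ^ (γ - 2) := by
      refine intervalIntegral.integral_mono_on ht.2.le
        (h.intervalIntegrable_laplaceDensity ht.1 one_pos)
        ((intervalIntegral.intervalIntegrable_rpow (Or.inr h0)).const_mul M) fun τ hτ => ?_
      exact hb τ (ht.1.trans_le hτ.1) (hτ.2.trans one_le_two)
    refine h1.trans ?_
    rw [intervalIntegral.integral_const_mul, integral_rpow (Or.inr ⟨by linarith, h0⟩), hK,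
      Real.one_rpow, show γ - 2 + 1 = γ - 1 by ring, div_mul_eq_mul_div, mul_div_assoc]
    refine mul_le_mul_of_nonneg_left ?_ hM
    rw [show (1 - t ^ (γ - 1)) / (γ - 1) = (t ^ (γ - 1) - 1) / (1 - γ) by
      rw [← neg_div_neg_eq]; ring]
    have : 0 < 1 - γ := by linarith
    gcongr
    linarith
  have hi : ∀ s : ℝ, -1 < s → IntegrableOn (fun t : ℝ => t ^ s) (Ioo 0 1) := fun s hs =>
    (intervalIntegral.integrableOn_Ioo_rpow_iff one_pos).2 hs
  -- With `α = γ/2` the worst exponent is `γ - 1 - γ/2 + γ²/4 = -1 + γ/2 + γ²/4 > -1`.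
  refine ⟨γ / 2, ⟨by linarith, by linarith⟩, ?_⟩
  have hdom : IntegrableOn (fun t : ℝ => K * t ^ (γ - 1 + (-(γ / 2) + (γ / 2) ^ 2))
      + |C₀| * t ^ (-(γ / 2) + (γ / 2) ^ 2)) (Ioo 0 1) := by
    refine ((hi _ ?_).const_mul K).add ((hi _ ?_).const_mul _) <;> nlinarith
  refine hdom.mono' ?_ ?_
  · refine ContinuousOn.aestronglyMeasurable ?_ measurableSet_Ioo
    exact hcont.abs.mul (continuousOn_id.rpow_const fun x hx => Or.inl hx.1.ne')
  · refine (ae_restrict_mem measurableSet_Ioo).mono fun t ht => ?_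
    have htp : 0 ≤ t ^ (-(γ / 2) + (γ / 2) ^ 2) := Real.rpow_nonneg ht.1.le _
    rw [Real.norm_of_nonneg (by positivity), Real.rpow_add ht.1 (γ - 1), ← mul_assoc,
      ← add_mul]
    exact mul_le_mul_of_nonneg_right (hKb t ht) htp

end AdmissibleDensity

/-! ### The force of a single exponential on an annulus, and Fubini -/

/-- The open annulus `{b < |y| < 1}`. -/
def openAnnulus (b : ℝ) : Set ℂ := {y | b < ‖y‖ ∧ ‖y‖ < 1}

lemma isOpen_openAnnulus (b : ℝ) : IsOpen (openAnnulus b) :=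
  (isOpen_lt continuous_const continuous_norm).inter (isOpen_lt continuous_norm continuous_const)

lemma measurableSet_openAnnulus (b : ℝ) : MeasurableSet (openAnnulus b) :=
  (isOpen_openAnnulus b).measurableSet

lemma openAnnulus_subset_ball (b : ℝ) : openAnnulus b ⊆ Metric.ball 0 1 :=
  fun y hy => by simpa using hy.2

lemma volume_openAnnulus_lt_top (b : ℝ) : volume (openAnnulus b) < ⊤ :=
  (measure_mono (openAnnulus_subset_ball b)).trans_lt measure_ball_lt_top

/-- The cosine of the angle between `r - y` and the positive real axis. -/
noncomputable def radialCos (r : ℝ) (y : ℂ) : ℝ := (r - y.re) / ‖(r : ℂ) - y‖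

lemma measurable_radialCos (r : ℝ) : Measurable (radialCos r) := by
  unfold radialCos; fun_prop

lemma abs_radialCos_le_one (r : ℝ) (y : ℂ) : |radialCos r y| ≤ 1 := by
  rw [radialCos, abs_div, abs_norm]
  refine div_le_one_of_le₀ ?_ (norm_nonneg _)
  simpa using Complex.abs_re_le_norm ((r : ℂ) - y)

/-- The (negated) radial force at the point `r` of the annulus for the kernel with
`-K₀'(t) = e^{-xt}`. -/
noncomputable def annulusForce (b r x : ℝ) : ℝ :=
  ∫ y in openAnnulus b, Real.exp (-‖(r : ℂ) - y‖ * x) * radialCos r y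

lemma integrableOn_norm_rpow {s : ℝ} (hs : -2 < s) (R : ℝ) :
    IntegrableOn (fun z : ℂ => ‖z‖ ^ s) (Metric.ball 0 R) := by
  rw [integrableOn_fun_norm_addHaar volume (f := fun t : ℝ => t ^ s), Complex.finrank_real_complex]
  have h1 : IntegrableOn (fun t : ℝ => t ^ (s + 1)) (Ioo 0 R) := by
    rcases le_or_gt R 0 with h | h
    · simp [Ioo_eq_empty_of_le h]
    · exact (intervalIntegral.integrableOn_Ioo_rpow_iff h).2 (by linarith)
  refine h1.congr_fun (fun t ht => ?_) measurableSet_Ioo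
  simp [Real.rpow_add_one ht.1.ne', mul_comm]

lemma integrableOn_norm_sub_rpow {s : ℝ} (hs : -2 < s) (R : ℝ) (a : ℂ) :
    IntegrableOn (fun y : ℂ => ‖a - y‖ ^ s) {y | ‖a - y‖ < R} := by
  have hp := Measure.measurePreserving_sub_left (volume : Measure ℂ) a
  have he : MeasurableEmbedding (fun y : ℂ => a - y) :=
    (MeasurableEquiv.subLeft a).measurableEmbedding
  have := (hp.integrableOn_comp_preimage he (s := Metric.ball 0 R)).2 (integrableOn_norm_rpow hs R)
  have hset : (fun y : ℂ => a - y) ⁻¹' Metric.ball 0 R = {y | ‖a - y‖ < R} := by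
    ext y; simp
  rwa [hset] at this

lemma openAnnulus_diff_ae_eq (b : ℝ) (a : ℂ) :
    (openAnnulus b \ {a} : Set ℂ) =ᵐ[volume] openAnnulus b :=
  sdiff_null_ae_eq_self (measure_singleton a)

lemma norm_sub_lt_two {r b : ℝ} (hr0 : 0 ≤ r) (hr : r ≤ 1) {y : ℂ} (hy : y ∈ openAnnulus b) :
    ‖(r : ℂ) - y‖ < 2 := by
  have h1 := norm_sub_le (r : ℂ) y
  have h2 : ‖(r : ℂ)‖ = r := by simp [abs_of_nonneg hr0]
  have := hy.2
  linarith

namespace AdmissibleDensity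

variable {S : Set ℝ} {f : ℝ → ℝ}

/-- The bound `t^(γ-2)` is locally integrable in the plane exactly because `γ > 0`; distances inside
the closed unit disc are at most 2, the range on which the bound is assumed. -/
lemma integrableOn_laplaceDensity_norm (h : AdmissibleDensity S f) (b : ℝ) {r : ℝ} (hr0 : 0 ≤ r)
    (hr : r ≤ 1) :
    IntegrableOn (fun y : ℂ => laplaceDensity S f ‖(r : ℂ) - y‖) (openAnnulus b) := by
  obtain ⟨M, γ, hγ0, hγ1, hb⟩ := h.bound
  -- The point `y = r` is removed: at distance 0 the Laplace transform is not controlled.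
  refine IntegrableOn.congr_set_ae ?_ (openAnnulus_diff_ae_eq b r).symm
  have hpos : ∀ y ∈ openAnnulus b \ {(r : ℂ)}, 0 < ‖(r : ℂ) - y‖ := fun y hy =>
    norm_pos_iff.2 (sub_ne_zero.2 fun h => hy.2 h.symm)
  have hm : MeasurableSet (openAnnulus b \ {(r : ℂ)}) :=
    (measurableSet_openAnnulus b).diff (measurableSet_singleton _)
  have hI : IntegrableOn (fun y : ℂ => M * ‖(r : ℂ) - y‖ ^ (γ - 2)) (openAnnulus b \ {(r : ℂ)}) :=
    ((integrableOn_norm_sub_rpow (by linarith) 2 (r : ℂ)).mono_set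
      fun y hy => norm_sub_lt_two hr0 hr hy.1).const_mul M
  refine hI.mono' ?_ ((ae_restrict_mem hm).mono fun y hy => ?_)
  · refine ContinuousOn.aestronglyMeasurable ?_ hm
    exact h.continuousOn_laplaceDensity.comp (by fun_prop) hpos
  · rw [Real.norm_of_nonneg (h.laplaceDensity_pos (hpos y hy)).le]
    exact hb _ (hpos y hy) (norm_sub_lt_two hr0 hr hy.1).le

/-- Since the cosine is at most 1 in absolute value, the `x`-integral of the norm is dominated by
the Laplace transform at `|r - y|`, which is integrable over the annulus. -/
lemma integrable_prod_force (h : AdmissibleDensity S f) (b : ℝ) {r : ℝ} (hr0 : 0 ≤ r)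
    (hr : r ≤ 1) :
    Integrable (fun p : ℂ × ℝ => f p.2 * Real.exp (-‖(r : ℂ) - p.1‖ * p.2) * radialCos r p.1)
      ((volume.restrict (openAnnulus b)).prod (volume.restrict S)) := by
  have hmeas : AEStronglyMeasurable
      (fun p : ℂ × ℝ => f p.2 * Real.exp (-‖(r : ℂ) - p.1‖ * p.2) * radialCos r p.1)
      ((volume.restrict (openAnnulus b)).prod (volume.restrict S)) := by
    refine AEMeasurable.aestronglyMeasurable ?_
    refine ((h.aemeasurable.comp_snd).mul (Measurable.aemeasurable (by fun_prop))).mul ?_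
    exact ((measurable_radialCos r).comp measurable_fst).aemeasurable
  refine (integrable_prod_iff hmeas).2 ⟨?_, ?_⟩
  · have hne : ∀ᵐ y ∂(volume.restrict (openAnnulus b)), y ≠ (r : ℂ) :=
      ae_restrict_of_ae (by simp [ae_iff])
    filter_upwards [hne] with y hy
    exact (h.integrableOn _ (norm_pos_iff.2 (sub_ne_zero.2 hy.symm))).mul_const _
  · refine Integrable.mono (h.integrableOn_laplaceDensity_norm b hr0 hr)
      hmeas.norm.integral_prod_right' ?_
    refine Filter.Eventually.of_forall fun y => ?_
    have h1 : ∫ x in S, ‖f x * Real.exp (-‖(r : ℂ) - y‖ * x) * radialCos r y‖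
        = laplaceDensity S f ‖(r : ℂ) - y‖ * |radialCos r y| := by
      rw [laplaceDensity, ← integral_mul_const]
      refine setIntegral_congr_fun h.measurableSet fun x hx => ?_
      simp only [norm_mul, Real.norm_eq_abs, abs_of_pos (h.pos x hx), Real.abs_exp]
    change ‖∫ x in S, ‖f x * Real.exp (-‖(r : ℂ) - y‖ * x) * radialCos r y‖‖ ≤ _
    rw [h1]
    simp only [norm_mul, Real.norm_eq_abs, abs_abs]
    exact mul_le_of_le_one_right (abs_nonneg _) (abs_radialCos_le_one r y)

lemma integrableOn_mul_annulusForce (h : AdmissibleDensity S f) (b : ℝ) {r : ℝ} (hr0 : 0 ≤ r)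
    (hr : r ≤ 1) : IntegrableOn (fun x => f x * annulusForce b r x) S := by
  have := (h.integrable_prod_force b hr0 hr).integral_prod_right
  simp only [mul_assoc, integral_const_mul] at this
  exact this

lemma integral_laplaceDensity_mul_radialCos (h : AdmissibleDensity S f) (b : ℝ) {r : ℝ}
    (hr0 : 0 ≤ r) (hr : r ≤ 1) :
    ∫ y in openAnnulus b, laplaceDensity S f ‖(r : ℂ) - y‖ * radialCos r y
      = ∫ x in S, f x * annulusForce b r x := by
  have := integral_integral_swap (f := fun (y : ℂ) (x : ℝ) =>
    f x * Real.exp (-‖(r : ℂ) - y‖ * x) * radialCos r y) (h.integrable_prod_force b hr0 hr)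
  simp only [integral_mul_const] at this
  rw [show (fun y : ℂ => laplaceDensity S f ‖(r : ℂ) - y‖ * radialCos r y)
    = fun y : ℂ => (∫ x in S, f x * Real.exp (-‖(r : ℂ) - y‖ * x)) * radialCos r y from rfl, this]
  simp only [mul_assoc, integral_const_mul]
  rfl

lemma integrableOn_laplaceDensity_mul_radialCos (h : AdmissibleDensity S f) (b : ℝ) {r : ℝ}
    (hr0 : 0 ≤ r) (hr : r ≤ 1) :
    IntegrableOn (fun y : ℂ => laplaceDensity S f ‖(r : ℂ) - y‖ * radialCos r y)
      (openAnnulus b) := by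
  refine (h.integrableOn_laplaceDensity_norm b hr0 hr).mul_bdd (c := 1)
    (measurable_radialCos r).aestronglyMeasurable (Filter.Eventually.of_forall fun y => ?_)
  simpa using abs_radialCos_le_one r y

end AdmissibleDensity

/-! ### Polar coordinates and the reduction of `V1`, `V2` -/

lemma integrableOn_comp_polarCoord_symm {F : ℂ → ℝ} (hF : Integrable F) :
    IntegrableOn (fun p : ℝ × ℝ => p.1 * F (Complex.polarCoord.symm p)) polarCoord.target := by
  have h1 : Integrable (fun p : ℝ × ℝ => F (Complex.measurableEquivRealProd.symm p)) :=
    (Complex.volume_preserving_equiv_real_prod.symm).integrable_comp_of_integrable hF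
  have h2 := h1.integrableOn (s := polarCoord.symm '' polarCoord.target)
  rw [integrableOn_image_iff_integrableOn_abs_det_fderiv_smul volume
    polarCoord.open_target.measurableSet
    (fun p _ => (hasFDerivAt_polarCoord_symm p).hasFDerivWithinAt) polarCoord.symm.injOn] at h2
  refine h2.congr_fun (fun p hp => ?_) polarCoord.open_target.measurableSet
  have hp0 : 0 < p.1 := hp.1
  simp only [det_fderivPolarCoordSymm, abs_of_pos hp0, smul_eq_mul]
  rfl

lemma polarCoord_symm_eq_circlePoint (p : ℝ × ℝ) :
    Complex.polarCoord.symm p = p.1 * circlePoint p.2 := by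
  rw [Complex.polarCoord_symm_apply, circlePoint, Complex.exp_mul_I]
  simp

lemma norm_circlePoint (θ : ℝ) : ‖circlePoint θ‖ = 1 := Complex.norm_exp_ofReal_mul_I θ

lemma setIntegral_openAnnulus {F : ℂ → ℝ} {b : ℝ} (hb0 : 0 ≤ b) (hb1 : b ≤ 1)
    (hF : IntegrableOn F (openAnnulus b)) :
    ∫ y in openAnnulus b, F y =
      ∫ η in (-Real.pi)..Real.pi, ∫ ρ in b..1, F (ρ * circlePoint η) * ρ := by
  have hA := measurableSet_openAnnulus b
  have hI := integrableOn_comp_polarCoord_symm ((integrable_indicator_iff hA).2 hF)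
  have hB : MeasurableSet (Ioo b 1 ×ˢ (univ : Set ℝ)) := measurableSet_Ioo.prod MeasurableSet.univ
  have heq : EqOn (fun p : ℝ × ℝ => p.1 * (openAnnulus b).indicator F (Complex.polarCoord.symm p))
      ((Ioo b 1 ×ˢ (univ : Set ℝ)).indicator fun p => F (p.1 * circlePoint p.2) * p.1)
      polarCoord.target := by
    intro p hp
    have hp0 : 0 < p.1 := hp.1
    have hmem : (p.1 : ℂ) * circlePoint p.2 ∈ openAnnulus b ↔ p ∈ Ioo b 1 ×ˢ (univ : Set ℝ) := by
      simp [openAnnulus, norm_circlePoint, abs_of_pos hp0]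
    simp only [polarCoord_symm_eq_circlePoint, indicator, hmem]
    split_ifs <;> ring
  have hinter : polarCoord.target ∩ (Ioo b 1 ×ˢ (univ : Set ℝ)) =
      Ioo b 1 ×ˢ Ioo (-Real.pi) Real.pi := by
    ext p
    simp only [polarCoord_target, mem_inter_iff, mem_prod, mem_Ioi, mem_Ioo, mem_univ, and_true]
    constructor
    · tauto
    · rintro ⟨h1, h2⟩; exact ⟨⟨hb0.trans_lt h1.1, h2⟩, h1⟩
  have hI2 : IntegrableOn (fun p : ℝ × ℝ => F (p.1 * circlePoint p.2) * p.1)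
      (Ioo b 1 ×ˢ Ioo (-Real.pi) Real.pi) := by
    have := hI.congr_fun heq polarCoord.open_target.measurableSet
    rw [IntegrableOn, integrable_indicator_iff hB, IntegrableOn, Measure.restrict_restrict hB,
      inter_comm, hinter] at this
    exact this
  rw [← integral_indicator hA, ← Complex.integral_comp_polarCoord_symm]
  simp only [smul_eq_mul]
  rw [setIntegral_congr_fun polarCoord.open_target.measurableSet heq, setIntegral_indicator hB,
    hinter]
  rw [IntegrableOn, Measure.volume_eq_prod, ← Measure.prod_restrict] at hI2
  rw [Measure.volume_eq_prod, ← Measure.prod_restrict, integral_prod_symm _ hI2,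
    intervalIntegral.integral_of_le (by linarith [Real.pi_pos]), integral_Ioc_eq_integral_Ioo]
  simp only [intervalIntegral.integral_of_le hb1, integral_Ioc_eq_integral_Ioo]

lemma fderiv_convolutionKernel_apply {K₀ : ℝ → ℝ} {k : ℝ} {x y : ℂ} (hxy : x ≠ y)
    (hK : HasDerivAt K₀ k ‖x - y‖) (v : ℂ) :
    fderiv ℝ (fun z : ℂ => convolutionKernel K₀ z y) x v = k * (inner ℝ (x - y) v / ‖x - y‖) := by
  have hne : ‖x - y‖ ≠ 0 := norm_ne_zero_iff.2 (sub_ne_zero.2 hxy)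
  have h1 : HasFDerivAt (fun z : ℂ => ‖z - y‖ ^ 2) _ x := ((hasFDerivAt_id x).sub_const y).norm_sq
  have h2 := h1.sqrt (by positivity)
  simp only [Real.sqrt_sq (norm_nonneg _)] at h2
  have h3 := hK.comp_hasFDerivAt x h2
  have h4 : HasFDerivAt (fun z : ℂ => convolutionKernel K₀ z y) _ x := h3
  rw [h4.fderiv]
  simp
  field_simp
  exact Or.inl (by ring)

lemma circlePoint_sub (a c : ℝ) : circlePoint a = circlePoint c * circlePoint (a - c) := by
  rw [circlePoint, circlePoint, circlePoint, ← Complex.exp_add]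
  congr 1
  push_cast
  ring

lemma circlePoint_periodic : Function.Periodic circlePoint (2 * Real.pi) := by
  intro η
  rw [circlePoint, circlePoint]
  push_cast
  rw [add_mul, Complex.exp_add, Complex.exp_two_pi_mul_I, mul_one]

namespace AdmissibleDensity

variable {S : Set ℝ} {f : ℝ → ℝ}

/-- Rotating the plane by `-θ` moves the evaluation point to the positive real axis, so only `η - θ`
remains; `ρ ≠ r` keeps away from the singularity of the kernel. -/
lemma fderiv_densityKernel (h : AdmissibleDensity S f) (C₀ : ℝ) {r ρ : ℝ} (hρ0 : 0 < ρ)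
    (hr0 : 0 < r) (hρr : ρ ≠ r) (θ η : ℝ) :
    fderiv ℝ (fun z : ℂ => convolutionKernel (densityKernel S f C₀) z (ρ * circlePoint η))
        (r * circlePoint θ) (circlePoint θ)
      = -(laplaceDensity S f ‖(r : ℂ) - ρ * circlePoint (η - θ)‖ *
        radialCos r (ρ * circlePoint (η - θ))) := by
  have hfac : (r : ℂ) * circlePoint θ - ρ * circlePoint η
      = circlePoint θ * ((r : ℂ) - ρ * circlePoint (η - θ)) := by
    rw [circlePoint_sub η θ]; ring
  have hne : (r : ℂ) * circlePoint θ ≠ ρ * circlePoint η := by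
    intro he
    have := congrArg norm he
    simp only [norm_mul, norm_circlePoint, mul_one, Complex.norm_real, Real.norm_eq_abs,
      abs_of_pos hρ0, abs_of_pos hr0] at this
    exact hρr this.symm
  have hpos : 0 < ‖(r : ℂ) * circlePoint θ - ρ * circlePoint η‖ :=
    norm_pos_iff.2 (sub_ne_zero.2 hne)
  rw [fderiv_convolutionKernel_apply hne (h.hasDerivAt_densityKernel C₀ hpos), hfac, norm_mul,
    norm_circlePoint, one_mul, radialCos, neg_mul]
  congr 3
  have hn : (starRingEnd ℂ) (circlePoint θ) * circlePoint θ = 1 := by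
    rw [Complex.conj_mul', norm_circlePoint]; simp
  rw [Complex.inner, map_mul, ← mul_assoc, mul_comm (circlePoint θ), hn, one_mul]
  simp

lemma patchGradient_densityKernel (h : AdmissibleDensity S f) (C₀ : ℝ) {b r : ℝ} (hb0 : 0 < b)
    (hb1 : b < 1) (hr0 : 0 < r) (hr1 : r ≤ 1) (θ : ℝ) :
    patchGradient (convolutionKernel (densityKernel S f C₀)) (fun _ => b) (fun _ => 1)
        (r * circlePoint θ) (circlePoint θ) = -∫ x in S, f x * annulusForce b r x := by
  set g : ℝ → ℝ := fun η => ∫ ρ in b..1, (laplaceDensity S f ‖(r : ℂ) - ρ * circlePoint η‖ *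
    radialCos r (ρ * circlePoint η)) * ρ with hg
  have hper : Function.Periodic g (2 * Real.pi) := fun η => by
    simp only [hg, circlePoint_periodic η]
  have hinner : ∀ η : ℝ, ∫ ρ in b..1,
      fderiv ℝ (fun z : ℂ => convolutionKernel (densityKernel S f C₀) z (ρ * circlePoint η))
        (r * circlePoint θ) (circlePoint θ) * ρ = -g (η - θ) := by
    intro η
    simp only [hg, ← intervalIntegral.integral_neg]
    -- The radius `ρ = r`, where the gradient formula may fail, is a null set.
    refine intervalIntegral.integral_congr_ae ?_
    filter_upwards [(volume : Measure ℝ).ae_ne r] with ρ hρ hmem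
    rw [uIoc_of_le hb1.le] at hmem
    rw [h.fderiv_densityKernel C₀ (hb0.trans hmem.1) hr0 hρ]
    ring
  rw [patchGradient]
  simp only [hinner]
  rw [intervalIntegral.integral_neg, intervalIntegral.integral_comp_sub_right (fun η => g η) θ,
    ← h.integral_laplaceDensity_mul_radialCos b hr0.le hr1,
    setIntegral_openAnnulus hb0.le hb1.le
      (h.integrableOn_laplaceDensity_mul_radialCos b hr0.le hr1)]
  -- Periodicity moves the angular window `[-θ, 2π - θ]` to the window `[-π, π]` of polar
  -- coordinates, which removes `θ`.
  have h1 := hper.intervalIntegral_add_eq (0 - θ) (-Real.pi)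
  rw [show 0 - θ + 2 * Real.pi = 2 * Real.pi - θ by ring,
    show -Real.pi + 2 * Real.pi = Real.pi by ring] at h1
  rw [h1]

lemma V1_densityKernel (h : AdmissibleDensity S f) (C₀ : ℝ) {b : ℝ} (hb : b ∈ Ioo (0 : ℝ) 1)
    (θ : ℝ) : V1 (convolutionKernel (densityKernel S f C₀)) b 0 0 θ
      = -∫ x in S, f x * (annulusForce b b x / b) := by
  have h1 : innerRadius b 0 = fun _ => b := by
    funext η; simp [innerRadius, Real.sqrt_sq hb.1.le]
  have h2 : outerRadius 0 = fun _ => 1 := by funext η; simp [outerRadius]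
  rw [V1, h1, h2, h.patchGradient_densityKernel C₀ hb.1 hb.2 hb.1 hb.2.le]
  simp only [← mul_div_assoc, integral_div]
  ring

lemma V2_densityKernel (h : AdmissibleDensity S f) (C₀ : ℝ) {b : ℝ} (hb : b ∈ Ioo (0 : ℝ) 1)
    (θ : ℝ) : V2 (convolutionKernel (densityKernel S f C₀)) b 0 0 θ
      = -∫ x in S, f x * annulusForce b 1 x := by
  have h1 : innerRadius b 0 = fun _ => b := by
    funext η; simp [innerRadius, Real.sqrt_sq hb.1.le]
  have h2 : outerRadius 0 = fun _ => 1 := by funext η; simp [outerRadius]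
  rw [V2, h1, h2]
  have := h.patchGradient_densityKernel C₀ hb.1 hb.2 one_pos le_rfl θ
  simp only [div_one, one_mul]
  exact this

end AdmissibleDensity

/-! ### Positivity and upper bound of the outer force -/

lemma volume_openAnnulus_le (b : ℝ) : volume.real (openAnnulus b) ≤ Real.pi := by
  have h := measureReal_mono (μ := (volume : Measure ℂ)) (openAnnulus_subset_ball b)
    measure_ball_lt_top.ne
  refine h.trans_eq ?_
  simp [Measure.real, Complex.volume_ball]

lemma volume_openAnnulus_ne_zero {b : ℝ} (hb : b ∈ Ioo (0 : ℝ) 1) :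
    volume (openAnnulus b) ≠ 0 := by
  refine ((isOpen_openAnnulus b).measure_pos volume ⟨(((b + 1) / 2 : ℝ) : ℂ), ?_⟩).ne'
  have h1 := hb.1
  have h2 := hb.2
  simp only [openAnnulus, mem_ofPred_eq, Complex.norm_real, Real.norm_eq_abs]
  rw [abs_of_pos (by linarith)]
  constructor <;> linarith

lemma integrableOn_exp_mul_radialCos {A : Set ℂ} (hA : volume A < ⊤) (r : ℝ) {x : ℝ}
    (hx : 0 ≤ x) :
    IntegrableOn (fun y : ℂ => Real.exp (-‖(r : ℂ) - y‖ * x) * radialCos r y) A := by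
  refine Measure.integrableOn_of_bounded (M := 1) hA.ne ?_ (Filter.Eventually.of_forall fun y => ?_)
  · have := measurable_radialCos r
    exact Measurable.aestronglyMeasurable (by fun_prop)
  · rw [norm_mul, Real.norm_eq_abs, Real.norm_eq_abs, Real.abs_exp]
    refine mul_le_one₀ (Real.exp_le_one_iff.2 ?_) (abs_nonneg _) (abs_radialCos_le_one r y)
    have := norm_nonneg ((r : ℂ) - y)
    nlinarith

lemma integrableOn_radialCos {A : Set ℂ} (hA : volume A < ⊤) (r : ℝ) :
    IntegrableOn (radialCos r) A := by
  simpa using integrableOn_exp_mul_radialCos hA r le_rfl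

lemma radialCos_one_pos {y : ℂ} (hy : ‖y‖ < 1) : 0 < radialCos 1 y := by
  have h1 : y.re < 1 := (Complex.re_le_norm y).trans_lt hy
  refine div_pos (by linarith) (norm_pos_iff.2 (sub_ne_zero.2 ?_))
  rintro rfl
  simp at hy

lemma setIntegral_pos_of_pos {A : Set ℂ} {g : ℂ → ℝ} (hA : MeasurableSet A) (h0 : volume A ≠ 0)
    (hg : ∀ y ∈ A, 0 < g y) (hi : IntegrableOn g A) : 0 < ∫ y in A, g y := by
  rw [setIntegral_pos_iff_support_of_nonneg_ae
    ((ae_restrict_mem hA).mono fun x hx => (hg x hx).le) hi]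
  rw [show Function.support g ∩ A = A from inter_eq_right.2 fun x hx => (hg x hx).ne']
  exact pos_iff_ne_zero.2 h0

lemma annulusForce_one_pos {b x : ℝ} (hb : b ∈ Ioo (0 : ℝ) 1) (hx : 0 ≤ x) :
    0 < annulusForce b 1 x :=
  setIntegral_pos_of_pos (measurableSet_openAnnulus b) (volume_openAnnulus_ne_zero hb)
    (fun _ hy => mul_pos (Real.exp_pos _) (radialCos_one_pos hy.2))
    (integrableOn_exp_mul_radialCos (volume_openAnnulus_lt_top b) 1 hx)

/-- The cosine is positive on the disc, so bounding the exponential by 1 and filling the hole both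
increase the integral; the bound is uniform in `b` and `x`. -/
lemma annulusForce_one_le {b x : ℝ} (hx : 0 ≤ x) :
    annulusForce b 1 x ≤ ∫ y in Metric.ball (0 : ℂ) 1, radialCos 1 y := by
  have hnn : ∀ y ∈ Metric.ball (0 : ℂ) 1, 0 ≤ radialCos 1 y := fun y hy =>
    (radialCos_one_pos (by simpa using hy)).le
  have hi := integrableOn_radialCos (A := Metric.ball (0 : ℂ) 1) measure_ball_lt_top 1
  calc annulusForce b 1 x ≤ ∫ y in openAnnulus b, radialCos 1 y := by
        refine setIntegral_mono_on
          (integrableOn_exp_mul_radialCos (volume_openAnnulus_lt_top b) 1 hx)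
          (integrableOn_radialCos (volume_openAnnulus_lt_top b) 1) (measurableSet_openAnnulus b)
          fun y hy => mul_le_of_le_one_left (hnn y (openAnnulus_subset_ball b hy))
            (Real.exp_le_one_iff.2 ?_)
        have := norm_nonneg (((1 : ℝ) : ℂ) - y)
        nlinarith
    _ ≤ _ := setIntegral_mono_set hi ((ae_restrict_mem measurableSet_ball).mono hnn)
        (LE.le.eventuallyLE (openAnnulus_subset_ball b))

/-- The cosine is at most 1 and strictly less on the upper half disc, while the disc has area `π`.
This strict gap drives the small `x` comparison. -/
lemma integral_ball_radialCos_one_lt_pi :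
    ∫ y in Metric.ball (0 : ℂ) 1, radialCos 1 y < Real.pi := by
  have hi := integrableOn_radialCos (A := Metric.ball (0 : ℂ) 1) measure_ball_lt_top 1
  have hi1 : IntegrableOn (fun _ : ℂ => (1 : ℝ)) (Metric.ball (0 : ℂ) 1) :=
    integrableOn_const measure_ball_lt_top.ne
  have h1 : ∫ _ in Metric.ball (0 : ℂ) 1, (1 : ℝ) = Real.pi := by
    simp [Measure.real, Complex.volume_ball]
  rw [← h1, ← sub_pos, ← integral_sub hi1 hi, setIntegral_pos_iff_support_of_nonneg_ae
    (Filter.Eventually.of_forall fun y =>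
      sub_nonneg.2 ((le_abs_self _).trans (abs_radialCos_le_one 1 y))) (hi1.sub hi)]
  have hU : IsOpen (Metric.ball (0 : ℂ) 1 ∩ {y | 0 < y.im}) :=
    Metric.isOpen_ball.inter (isOpen_lt continuous_const Complex.continuous_im)
  refine (hU.measure_pos volume ⟨Complex.I / 2, by simp; norm_num, by simp⟩).trans_le
    (measure_mono fun y hy => ⟨?_, hy.1⟩)
  have him : 0 < y.im := hy.2
  refine (sub_pos.2 ?_).ne'
  have hn : (((1 : ℝ) : ℂ) - y).re < ‖((1 : ℝ) : ℂ) - y‖ :=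
    (le_abs_self _).trans_lt (Complex.abs_re_lt_norm.2 (by simpa using him.ne'))
  rw [radialCos, div_lt_one (norm_pos_iff.2 fun h0 => ?_)]
  · simpa using hn
  · have := congrArg Complex.im h0
    simp at this
    exact him.ne' this

/-! ### Large `x` -/

/-- The open half disc `{|w| < 1, Re w > 0}`. -/
def halfDisc : Set ℂ := {w | ‖w‖ < 1 ∧ 0 < w.re}

lemma isOpen_halfDisc : IsOpen halfDisc :=
  (isOpen_lt continuous_norm continuous_const).inter
    (isOpen_lt continuous_const Complex.continuous_re)

lemma integrableOn_halfDisc :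
    IntegrableOn (fun w : ℂ => Real.exp (-‖w‖) * (w.re / ‖w‖)) halfDisc := by
  have hfin : volume halfDisc ≠ ⊤ :=
    ((measure_mono fun w hw => by simpa using hw.1).trans_lt
      (measure_ball_lt_top (x := (0 : ℂ)) (r := 1))).ne
  refine Measure.integrableOn_of_bounded (M := 1) hfin
    (Measurable.aestronglyMeasurable (by fun_prop)) (Filter.Eventually.of_forall fun w => ?_)
  rw [norm_mul, Real.norm_eq_abs, Real.norm_eq_abs, Real.abs_exp, abs_div, abs_norm]
  exact mul_le_one₀ (Real.exp_le_one_iff.2 (by simp)) (by positivity)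
    (div_le_one_of_le₀ (Complex.abs_re_le_norm w) (norm_nonneg w))

lemma integral_halfDisc_pos :
    0 < ∫ w in halfDisc, Real.exp (-‖w‖) * (w.re / ‖w‖) := by
  refine setIntegral_pos_of_pos isOpen_halfDisc.measurableSet
    (isOpen_halfDisc.measure_pos volume ⟨1 / 2, ?_⟩).ne' (fun w hw => ?_) integrableOn_halfDisc
  · constructor <;> norm_num
  · have : w ≠ 0 := by rintro rfl; simpa using hw.2
    exact mul_pos (Real.exp_pos _) (div_pos hw.2 (norm_pos_iff.2 this))

lemma integrable_exp_neg_norm_mul_norm : Integrable (fun w : ℂ => Real.exp (-‖w‖) * ‖w‖) := by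
  rw [integrable_fun_norm_addHaar volume (f := fun t : ℝ => Real.exp (-t) * t),
    Complex.finrank_real_complex]
  refine (Real.GammaIntegral_convergent (s := 3) (by norm_num)).congr_fun (fun t ht => ?_)
    measurableSet_Ioi
  rw [show (3 : ℝ) - 1 = (2 : ℕ) by norm_num]
  simp only [Real.rpow_natCast, smul_eq_mul]
  ring

lemma norm_sq_eq_re_im (w : ℂ) : ‖w‖ ^ 2 = w.re ^ 2 + w.im ^ 2 := by
  rw [Complex.sq_norm, Complex.normSq_apply]; ring

/-- In the variable `w = x(y - b)`, the half disc lies in the rescaled annulus and gives a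
favourable term `x^{-2} ∫ P`. Elsewhere the unfavourable cosine is at most `|y - b| / (2b)` because
`|y| > b`, so its contribution is at most `x^{-3} ∫ N / (2b)`. -/
lemma exists_annulusForce_neg {b : ℝ} (hb : b ∈ Ioo (0 : ℝ) 1) :
    ∃ X : ℝ, 0 < X ∧ ∀ x : ℝ, X < x → annulusForce b b x < 0 := by
  obtain ⟨hb0, hb1⟩ := hb
  set P : ℂ → ℝ := halfDisc.indicator fun w => Real.exp (-‖w‖) * (w.re / ‖w‖) with hP
  set N : ℂ → ℝ := fun w => Real.exp (-‖w‖) * ‖w‖ with hN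
  have hPi : Integrable P := (integrable_indicator_iff isOpen_halfDisc.measurableSet).2
    integrableOn_halfDisc
  have hNi : Integrable N := integrable_exp_neg_norm_mul_norm
  have hP0 : 0 < ∫ w, P w := by
    rw [hP, integral_indicator isOpen_halfDisc.measurableSet]; exact integral_halfDisc_pos
  have hN0 : 0 ≤ ∫ w, N w := integral_nonneg fun w => by positivity
  -- The first threshold makes the half disc of radius `1/x` at `b` fit below the outer circle; the
  -- second makes the `x^{-2}` term beat the `x^{-3}` term.
  refine ⟨max (1 / (1 - b)) ((∫ w, N w) / (2 * b * ∫ w, P w)),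
    lt_max_of_lt_left (by have := sub_pos.2 hb1; positivity), fun x hx => ?_⟩
  have hx1 : 1 / (1 - b) < x := (le_max_left _ _).trans_lt hx
  have hx2 : (∫ w, N w) / (2 * b * ∫ w, P w) < x := (le_max_right _ _).trans_lt hx
  have hc : 0 < 1 - b := sub_pos.2 hb1
  have hx0 : 0 < x := lt_trans (by positivity) hx1
  rw [div_lt_iff₀ hc] at hx1
  have hscale : ∀ g : ℂ → ℝ, ∫ y, g (x • (y - b)) = (x ^ 2)⁻¹ * ∫ w, g w := by
    intro g
    rw [integral_sub_right_eq_self (fun y : ℂ => g (x • y)) (b : ℂ), Measure.integral_comp_smul,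
      Complex.finrank_real_complex, abs_of_pos (by positivity), smul_eq_mul]
  have hint : ∀ g : ℂ → ℝ, Integrable g → Integrable fun y : ℂ => g (x • (y - b)) := by
    intro g hg
    exact ((integrable_comp_smul_iff volume g hx0.ne').2 hg).comp_sub_right (b : ℂ)
  have hsupp : ∀ y : ℂ, y ∉ openAnnulus b → P (x • (y - b)) = 0 := by
    intro y hy
    refine indicator_of_notMem (fun hmem => hy ?_) _
    obtain ⟨h1, h2⟩ := hmem
    rw [norm_smul, Real.norm_of_nonneg hx0.le] at h1
    have h3 : 0 < y.re - b := by
      have : 0 < x * (y.re - b) := by simpa using h2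
      exact pos_of_mul_pos_right this hx0.le
    have h4 : ‖y - b‖ < 1 - b := by nlinarith
    have h5 : ‖y‖ ≤ ‖y - b‖ + b := by
      have := norm_add_le (y - b) (b : ℂ)
      simpa [abs_of_pos hb0] using this
    exact ⟨by linarith [Complex.re_le_norm y], by linarith⟩
  have hpt : ∀ y ∈ openAnnulus b, P (x • (y - b)) - 1 / (2 * b * x) * N (x • (y - b)) ≤
      -(Real.exp (-‖(b : ℂ) - y‖ * x) * radialCos b y) := by
    intro y hy
    have hnorm : ‖x • (y - (b : ℂ))‖ = x * ‖y - (b : ℂ)‖ := by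
      rw [norm_smul, Real.norm_of_nonneg hx0.le]
    have hexp : Real.exp (-‖(b : ℂ) - y‖ * x) = Real.exp (-(x * ‖y - (b : ℂ)‖)) := by
      rw [norm_sub_rev]; ring_nf
    set d := ‖y - (b : ℂ)‖ with hd
    set E := Real.exp (-(x * d)) with hE
    have hEpos : 0 < E := Real.exp_pos _
    have hd0 : 0 ≤ d := norm_nonneg _
    have hrc : -radialCos b y = (y.re - b) / d := by
      rw [radialCos, norm_sub_rev, ← hd]; ring
    have hNv : 1 / (2 * b * x) * N (x • (y - b)) = E * (d / (2 * b)) := by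
      simp only [hN, hnorm, ← hE]; field_simp
    have hdsq : d ^ 2 = (y.re - b) ^ 2 + y.im ^ 2 := by
      rw [hd, norm_sq_eq_re_im]; simp
    rw [hexp, ← mul_neg, hrc, hNv]
    -- Equivalent, for `d > 0`, to `2b(Re y - b) + d² ≥ 0`, whose left side is `|y|² - b²`.
    have hlow : -(d / (2 * b)) ≤ (y.re - b) / d := by
      rcases hd0.eq_or_lt with h0 | h0
      · simp [← h0]
      · rw [le_div_iff₀ h0, neg_mul, neg_le_iff_add_nonneg]
        have h1 : b ^ 2 < ‖y‖ ^ 2 := by have := hy.1; gcongr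
        rw [norm_sq_eq_re_im] at h1
        have : (y.re - b) + d / (2 * b) * d = (2 * b * (y.re - b) + d ^ 2) / (2 * b) := by
          field_simp
        rw [this, hdsq]
        apply div_nonneg _ (by positivity)
        nlinarith
    have hdb : 0 ≤ d / (2 * b) := by positivity
    by_cases hmem : x • (y - (b : ℂ)) ∈ halfDisc
    · have : P (x • (y - b)) = E * ((y.re - b) / d) := by
        simp only [hP, indicator_of_mem hmem, hnorm]
        rw [show (x • (y - (b : ℂ))).re = x * (y.re - b) by simp,
          mul_div_mul_left _ _ hx0.ne']
      rw [this]
      linarith [mul_nonneg hEpos.le hdb]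
    · have : P (x • (y - b)) = 0 := indicator_of_notMem hmem _
      rw [this]
      have := mul_le_mul_of_nonneg_left hlow hEpos.le
      linarith
  have hPA : ∫ y in openAnnulus b, P (x • (y - b)) = (x ^ 2)⁻¹ * ∫ w, P w := by
    rw [← hscale P]
    exact setIntegral_eq_integral_of_forall_compl_eq_zero hsupp
  have hNA : ∫ y in openAnnulus b, N (x • (y - b)) ≤ (x ^ 2)⁻¹ * ∫ w, N w := by
    rw [← hscale N]
    exact setIntegral_le_integral (hint N hNi)
      (Filter.Eventually.of_forall fun y => by simp only [hN, Pi.zero_apply]; positivity)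
  have hmain := setIntegral_mono_on
    ((hint P hPi).integrableOn.sub ((hint N hNi).integrableOn.const_mul (1 / (2 * b * x))))
    (integrableOn_exp_mul_radialCos (volume_openAnnulus_lt_top b) b hx0.le).neg
    (measurableSet_openAnnulus b) hpt
  rw [integral_neg', integral_sub' (hint P hPi).integrableOn
    ((hint N hNi).integrableOn.const_mul _), integral_const_mul, hPA] at hmain
  rw [annulusForce]
  refine neg_pos.1 (lt_of_lt_of_le ?_ hmain)
  have h1 : 1 / (2 * b * x) * ∫ y in openAnnulus b, N (x • (y - b)) ≤
      1 / (2 * b * x) * ((x ^ 2)⁻¹ * ∫ w, N w) := by gcongr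
  have h2 : 1 / (2 * b * x) * (∫ w, N w) < ∫ w, P w := by
    rw [div_lt_iff₀ (by positivity)] at hx2
    rw [one_div_mul_eq_div, div_lt_iff₀ (by positivity)]
    linarith
  have h3 : 1 / (2 * b * x) * ((x ^ 2)⁻¹ * ∫ w, N w) < (x ^ 2)⁻¹ * ∫ w, P w := by
    rw [mul_left_comm]
    exact mul_lt_mul_of_pos_left h2 (by positivity)
  linarith

/-! ### Small `x` -/

lemma exp_sub_exp_le {x s : ℝ} (hx : 0 ≤ x) (hs : 0 ≤ s) (r : ℝ) :
    Real.exp (-s * x) - Real.exp (-r * x) ≤ x * |r - s| := by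
  rcases le_total s r with h | h
  · have h1 : Real.exp (-r * x) = Real.exp (-s * x) * Real.exp (-(x * (r - s))) := by
      rw [← Real.exp_add]; ring_nf
    have h2 : 1 - Real.exp (-(x * (r - s))) ≤ x * (r - s) := by
      linarith [Real.add_one_le_exp (-(x * (r - s)))]
    have h3 : Real.exp (-s * x) ≤ 1 := Real.exp_le_one_iff.2 (by nlinarith)
    have h4 : 0 ≤ x * (r - s) := mul_nonneg hx (sub_nonneg.2 h)
    rw [abs_of_nonneg (sub_nonneg.2 h), h1]
    nlinarith [Real.exp_pos (-s * x)]
  · have h1 : Real.exp (-s * x) ≤ Real.exp (-r * x) := Real.exp_le_exp.2 (by nlinarith)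
    have : 0 ≤ x * |r - s| := by positivity
    linarith

lemma abs_exp_sub_exp_le {x s r : ℝ} (hx : 0 ≤ x) (hs : 0 ≤ s) (hr : 0 ≤ r) :
    |Real.exp (-s * x) - Real.exp (-r * x)| ≤ x * |r - s| := by
  refine abs_sub_le_iff.2 ⟨exp_sub_exp_le hx hs r, ?_⟩
  rw [abs_sub_comm]
  exact exp_sub_exp_le hx hr s

lemma one_sub_exp_div_le {x r : ℝ} (hx : 0 ≤ x) (hr : 0 ≤ r) :
    |(1 - Real.exp (-r * x)) / r| ≤ x := by
  have h1 : 0 ≤ 1 - Real.exp (-r * x) := sub_nonneg.2 (Real.exp_le_one_iff.2 (by nlinarith))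
  rw [abs_of_nonneg (div_nonneg h1 hr)]
  refine div_le_of_le_mul₀ hr hx ?_
  linarith [Real.add_one_le_exp (-r * x)]

/-- The first component of the vector field `(1 - e^{-x|z|}) z / |z|` is `3x`-Lipschitz. -/
lemma abs_one_sub_exp_mul_re_sub_le {x : ℝ} (hx : 0 ≤ x) (z w : ℂ) :
    |(1 - Real.exp (-‖z‖ * x)) * (z.re / ‖z‖) - (1 - Real.exp (-‖w‖ * x)) * (w.re / ‖w‖)| ≤
      3 * x * ‖z - w‖ := by
  set g : ℝ → ℝ := fun r => (1 - Real.exp (-r * x)) / r with hg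
  -- At `r = 0` both sides vanish, whatever value division by zero gives to `g`; the identities
  -- below thus need no case split.
  have hgr : ∀ r : ℝ, g r * r = 1 - Real.exp (-r * x) := by
    intro r
    rcases eq_or_ne r 0 with rfl | h
    · simp
    · simp [hg, h]
  have hz := norm_nonneg z
  have hw := norm_nonneg w
  have hzw : |‖z‖ - ‖w‖| ≤ ‖z - w‖ := abs_norm_sub_norm_le z w
  have hre : |z.re - w.re| ≤ ‖z - w‖ := by simpa using Complex.abs_re_le_norm (z - w)
  have hgz : |g ‖z‖| ≤ x := one_sub_exp_div_le hx hz
  have h1 : |g ‖z‖ - g ‖w‖| * ‖w‖ ≤ 2 * (x * ‖z - w‖) := by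
    -- Multiplying by `‖w‖` trades the variation of `g` for those of the norm and of the
    -- exponential, both explicitly Lipschitz.
    have e : (g ‖z‖ - g ‖w‖) * ‖w‖ = g ‖z‖ * (‖w‖ - ‖z‖)
        + (Real.exp (-‖w‖ * x) - Real.exp (-‖z‖ * x)) := by
      linear_combination hgr ‖z‖ - hgr ‖w‖
    rw [← abs_of_nonneg hw, ← abs_mul, abs_of_nonneg hw, e]
    refine (abs_add_le _ _).trans ?_
    have h2 := abs_exp_sub_exp_le hx hw hz
    have h3 : |g ‖z‖ * (‖w‖ - ‖z‖)| ≤ x * ‖z - w‖ := by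
      rw [abs_mul, abs_sub_comm]; gcongr
    have h4 : x * |‖z‖ - ‖w‖| ≤ x * ‖z - w‖ := by gcongr
    linarith
  have e : (1 - Real.exp (-‖z‖ * x)) * (z.re / ‖z‖) - (1 - Real.exp (-‖w‖ * x)) * (w.re / ‖w‖)
      = g ‖z‖ * (z.re - w.re) + (g ‖z‖ - g ‖w‖) * w.re := by
    simp only [hg]; ring
  rw [e]
  refine (abs_add_le _ _).trans ?_
  have h5 : |g ‖z‖ * (z.re - w.re)| ≤ x * ‖z - w‖ := by rw [abs_mul]; gcongr
  have h6 : |(g ‖z‖ - g ‖w‖) * w.re| ≤ |g ‖z‖ - g ‖w‖| * ‖w‖ := by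
    rw [abs_mul]; gcongr; exact Complex.abs_re_le_norm w
  linarith

lemma setIntegral_openAnnulus_of_odd (b : ℝ) {F : ℂ → ℝ} (hF : ∀ y, F (-y) = -F y) :
    ∫ y in openAnnulus b, F y = 0 := by
  have hs : (fun y : ℂ => -y) ⁻¹' openAnnulus b = openAnnulus b := by
    ext y; simp [openAnnulus]
  have h := (Measure.measurePreserving_neg (volume : Measure ℂ)).setIntegral_preimage_emb
    (MeasurableEquiv.neg ℂ).measurableEmbedding F (openAnnulus b)
  rw [hs] at h
  simp only [hF, integral_neg] at h
  linarith

lemma radialCos_zero_neg (y : ℂ) : radialCos 0 (-y) = -radialCos 0 y := by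
  simp [radialCos, neg_div]

/-- The loss is the integral of the field `(1 - e^{-x|z|}) z/|z|` at `z = b - y`. The same integral
with centre 0 vanishes by oddness, so subtracting it leaves a Lipschitz increment `3xb` on area at
most `π`. The factor `b` survives the later division by `b`. -/
lemma annulusForce_zero_le {b x : ℝ} (hb : 0 ≤ b) (hx : 0 ≤ x) :
    annulusForce b b 0 ≤ annulusForce b b x + 3 * x * b * Real.pi := by
  have hA := volume_openAnnulus_lt_top b
  have hodd : ∫ y in openAnnulus b, (1 - Real.exp (-‖((0 : ℝ) : ℂ) - y‖ * x)) * radialCos 0 y = 0 :=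
    setIntegral_openAnnulus_of_odd b fun y => by simp [radialCos_zero_neg]
  have hi : ∀ r : ℝ, IntegrableOn
      (fun y : ℂ => (1 - Real.exp (-‖(r : ℂ) - y‖ * x)) * radialCos r y) (openAnnulus b) := by
    intro r
    simp only [sub_mul, one_mul]
    exact (integrableOn_radialCos hA r).sub (integrableOn_exp_mul_radialCos hA r hx)
  have h1 : annulusForce b b 0 - annulusForce b b x =
      ∫ y in openAnnulus b, ((1 - Real.exp (-‖(b : ℂ) - y‖ * x)) * radialCos b y -
        (1 - Real.exp (-‖((0 : ℝ) : ℂ) - y‖ * x)) * radialCos 0 y) := by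
    rw [integral_sub (hi b) (hi 0), hodd, sub_zero, annulusForce, annulusForce,
      ← integral_sub (integrableOn_exp_mul_radialCos hA b le_rfl)
        (integrableOn_exp_mul_radialCos hA b hx)]
    simp [sub_mul]
  have h2 : annulusForce b b 0 - annulusForce b b x ≤
      (3 * x * b) * volume.real (openAnnulus b) := by
    rw [h1]
    refine (Real.le_norm_self _).trans ?_
    refine norm_setIntegral_le_of_norm_le_const hA fun y _ => ?_
    have := abs_one_sub_exp_mul_re_sub_le hx ((b : ℂ) - y) (((0 : ℝ) : ℂ) - y)
    have hn : ‖(b : ℂ) - y - (((0 : ℝ) : ℂ) - y)‖ = b := by simp [abs_of_nonneg hb]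
    rw [hn] at this
    simpa [radialCos] using this
  have h3 : (3 * x * b) * volume.real (openAnnulus b) ≤ 3 * x * b * Real.pi :=
    mul_le_mul_of_nonneg_left (volume_openAnnulus_le b) (by positivity)
  linarith

/-- The direction field `z / |z|` has Lipschitz constant at most `2 / |w|` at `w`. -/
lemma abs_re_div_norm_sub_le (z : ℂ) {w : ℂ} (hw : w ≠ 0) :
    |z.re / ‖z‖ - w.re / ‖w‖| ≤ 2 * ‖z - w‖ / ‖w‖ := by
  have hw0 : 0 < ‖w‖ := norm_pos_iff.2 hw
  rcases eq_or_ne z 0 with rfl | hz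
  · simp only [Complex.zero_re, zero_div, zero_sub, norm_neg, abs_neg, abs_div, abs_norm]
    gcongr
    linarith [Complex.abs_re_le_norm w]
  · have hz0 : 0 < ‖z‖ := norm_pos_iff.2 hz
    have e : z.re / ‖z‖ - w.re / ‖w‖ = (z.re / ‖z‖ * (‖w‖ - ‖z‖) + (z.re - w.re)) / ‖w‖ := by
      field_simp; ring
    rw [e, abs_div, abs_of_pos hw0]
    gcongr
    refine (abs_add_le _ _).trans ?_
    have h1 : |z.re - w.re| ≤ ‖z - w‖ := by simpa using Complex.abs_re_le_norm (z - w)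
    have h2 : |z.re / ‖z‖| ≤ 1 := by
      rw [abs_div, abs_norm]
      exact div_le_one_of_le₀ (Complex.abs_re_le_norm z) (norm_nonneg z)
    have h3 : |‖w‖ - ‖z‖| ≤ ‖z - w‖ := by
      rw [abs_sub_comm]; exact abs_norm_sub_norm_le z w
    rw [abs_mul]
    nlinarith [abs_nonneg (z.re / ‖z‖), abs_nonneg (‖w‖ - ‖z‖)]

lemma hasDerivAt_radialCos_zero {y : ℂ} (hy : y ≠ 0) :
    HasDerivAt (fun b : ℝ => radialCos b y) (y.im ^ 2 / ‖y‖ ^ 3) 0 := by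
  have hn : 0 < ‖y‖ := norm_pos_iff.2 hy
  have hnorm : ∀ b : ℝ, ‖(b : ℂ) - y‖ = Real.sqrt ((b - y.re) ^ 2 + y.im ^ 2) := by
    intro b
    rw [← Real.sqrt_sq (norm_nonneg ((b : ℂ) - y)), norm_sq_eq_re_im]
    simp
  have h0 : Real.sqrt ((0 - y.re) ^ 2 + y.im ^ 2) = ‖y‖ := by
    rw [← hnorm 0]; simp
  have hsq : (0 - y.re) ^ 2 + y.im ^ 2 ≠ 0 := by
    intro h; rw [h, Real.sqrt_zero] at h0; exact hn.ne h0
  have hd : HasDerivAt (fun b : ℝ => b - y.re) 1 0 := (hasDerivAt_id 0).sub_const y.re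
  have hs := ((hd.pow 2).add_const (y.im ^ 2)).sqrt hsq
  simp only [Pi.pow_apply] at hs
  have hq := hd.div hs (by rw [h0]; exact hn.ne')
  rw [show (fun b : ℝ => radialCos b y)
    = fun b => (b - y.re) / Real.sqrt ((b - y.re) ^ 2 + y.im ^ 2) from
      funext fun b => by rw [radialCos, hnorm]]
  refine hq.congr_deriv ?_
  rw [h0]
  have := norm_sq_eq_re_im y
  field_simp
  linear_combination 2 * this

lemma integral_im_sq_div_norm_cube :
    IntegrableOn (fun y : ℂ => y.im ^ 2 / ‖y‖ ^ 3) (openAnnulus 0) ∧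
    ∫ y in openAnnulus 0, y.im ^ 2 / ‖y‖ ^ 3 = Real.pi := by
  have hi : IntegrableOn (fun y : ℂ => y.im ^ 2 / ‖y‖ ^ 3) (openAnnulus 0) := by
    refine Integrable.mono' ((integrableOn_norm_rpow (s := -1) (by norm_num) 1).mono_set
      (openAnnulus_subset_ball 0)) (Measurable.aestronglyMeasurable (by fun_prop))
      ((ae_restrict_mem (measurableSet_openAnnulus 0)).mono fun y hy => ?_)
    have hy0 : 0 < ‖y‖ := hy.1
    rw [Real.norm_of_nonneg (by positivity), Real.rpow_neg_one, div_le_iff₀ (by positivity)]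
    have : ‖y‖⁻¹ * ‖y‖ ^ 3 = ‖y‖ ^ 2 := by field_simp
    rw [this, norm_sq_eq_re_im]
    nlinarith [sq_nonneg y.re]
  refine ⟨hi, ?_⟩
  rw [setIntegral_openAnnulus le_rfl zero_le_one hi]
  have hin : ∀ η : ℝ, ∫ ρ in (0 : ℝ)..1,
      ((ρ : ℂ) * circlePoint η).im ^ 2 / ‖(ρ : ℂ) * circlePoint η‖ ^ 3 * ρ = Real.sin η ^ 2 := by
    intro η
    have him : (circlePoint η).im = Real.sin η := Complex.exp_ofReal_mul_I_im η
    have : ∫ ρ in (0 : ℝ)..1,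
      ((ρ : ℂ) * circlePoint η).im ^ 2 / ‖(ρ : ℂ) * circlePoint η‖ ^ 3 * ρ
        = ∫ _ in (0 : ℝ)..1, Real.sin η ^ 2 := by
      refine intervalIntegral.integral_congr_ae (Filter.Eventually.of_forall fun ρ hρ => ?_)
      rw [uIoc_of_le zero_le_one] at hρ
      have hρ0 : 0 < ρ := hρ.1
      rw [Complex.im_ofReal_mul ρ (circlePoint η), norm_mul,
        norm_circlePoint, him, mul_one, Complex.norm_real, Real.norm_of_nonneg hρ0.le]
      field_simp
    rw [this]
    simp
  simp only [hin, integral_sin_sq]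
  simp

/-- Subtracting the integral with centre 0, zero by oddness, turns the quotient into a difference
quotient of the cosine in `b`. It is dominated by `2/|y|` and converges pointwise to `(Im y)²/|y|³`,
whose integral is `π`. -/
lemma tendsto_annulusForce_div :
    Filter.Tendsto (fun b : ℝ => annulusForce b b 0 / b) (𝓝[>] 0) (𝓝 Real.pi) := by
  rw [← integral_im_sq_div_norm_cube.2]
  have hform : ∀ b : ℝ, 0 < b → annulusForce b b 0 / b = ∫ y in openAnnulus 0,
      (openAnnulus b).indicator (fun y => (radialCos b y - radialCos 0 y) / b) y := by
    intro b hb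
    have hA := volume_openAnnulus_lt_top b
    have hsub : openAnnulus 0 ∩ openAnnulus b = openAnnulus b :=
      inter_eq_right.2 fun y hy => ⟨hb.trans hy.1, hy.2⟩
    rw [setIntegral_indicator (measurableSet_openAnnulus b), hsub, integral_div,
      integral_sub (integrableOn_radialCos hA b) (integrableOn_radialCos hA 0),
      setIntegral_openAnnulus_of_odd b radialCos_zero_neg, sub_zero, annulusForce]
    simp
  have hev : (fun b : ℝ => ∫ y in openAnnulus 0,
      (openAnnulus b).indicator (fun y => (radialCos b y - radialCos 0 y) / b) y)
      =ᶠ[𝓝[>] 0] fun b => annulusForce b b 0 / b := by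
    filter_upwards [self_mem_nhdsWithin] with b hb using (hform b hb).symm
  refine Filter.Tendsto.congr' hev ?_
  refine tendsto_integral_filter_of_dominated_convergence (fun y => 2 * ‖y‖ ^ (-1 : ℝ)) ?_ ?_ ?_ ?_
  · refine Filter.Eventually.of_forall fun b => Measurable.aestronglyMeasurable ?_
    exact (((measurable_radialCos b).sub (measurable_radialCos 0)).div_const b).indicator
      (measurableSet_openAnnulus b)
  · filter_upwards [self_mem_nhdsWithin] with b hb
    have hb0 : 0 < b := hb
    filter_upwards [ae_restrict_mem (measurableSet_openAnnulus 0)] with y hy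
    have hy0 : 0 < ‖y‖ := hy.1
    refine (norm_indicator_le_norm_self _ _).trans ?_
    rw [norm_div, Real.norm_of_nonneg hb0.le, Real.norm_eq_abs, div_le_iff₀ hb0, Real.rpow_neg_one]
    have := abs_re_div_norm_sub_le ((b : ℂ) - y) (w := ((0 : ℝ) : ℂ) - y)
      (by simpa using norm_pos_iff.1 hy0)
    have hn : ‖(b : ℂ) - y - (((0 : ℝ) : ℂ) - y)‖ = b := by simp [abs_of_pos hb0]
    rw [hn] at this
    refine le_trans (by simpa [radialCos] using this) (le_of_eq ?_)
    field_simp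
  · exact ((integrableOn_norm_rpow (s := -1) (by norm_num) 1).mono_set
      (openAnnulus_subset_ball 0)).const_mul 2
  · filter_upwards [ae_restrict_mem (measurableSet_openAnnulus 0)] with y hy
    have hy0 : 0 < ‖y‖ := hy.1
    have hd := (hasDerivAt_iff_tendsto_slope_zero.1
      (hasDerivAt_radialCos_zero (norm_pos_iff.1 hy0))).mono_left
        (nhdsWithin_mono 0 (fun b (hb : (0 : ℝ) < b) => hb.ne' : Ioi (0 : ℝ) ⊆ {0}ᶜ))
    refine hd.congr' ?_
    -- Once `b < |y|` the shrinking hole no longer contains `y`, and the indicator is 1.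
    filter_upwards [nhdsWithin_le_nhds (Iio_mem_nhds hy0)] with b hb
    have hmem : y ∈ openAnnulus b := ⟨hb, hy.2⟩
    rw [indicator_of_mem hmem]
    simp [div_eq_inv_mul]

lemma exists_annulusForce_lt : ∃ b_star x_star : ℝ, b_star ∈ Ioo (0 : ℝ) 1 ∧ 0 < x_star ∧
    ∀ b ∈ Ioo (0 : ℝ) b_star, ∀ x ∈ Ioo (0 : ℝ) x_star,
      annulusForce b 1 x < annulusForce b b x / b := by
  set κ := ∫ y in Metric.ball (0 : ℂ) 1, radialCos 1 y with hκ
  have hκπ : κ < Real.pi := integral_ball_radialCos_one_lt_pi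
  have hev := tendsto_annulusForce_div.eventually_const_lt
    (show (Real.pi + κ) / 2 < Real.pi by linarith)
  obtain ⟨c, hc0, hc⟩ := mem_nhdsGT_iff_exists_Ioo_subset.1 hev
  have hc0' : 0 < c := hc0
  -- `F(b, 0)/b > (π + κ)/2` leaves a margin `(π - κ)/2` above `κ`; the loss `3πx` stays below it
  -- exactly when `x < (π - κ)/(6π)`.
  refine ⟨min c (1 / 2), (Real.pi - κ) / (6 * Real.pi), ⟨by positivity,
    (min_le_right _ _).trans_lt (by norm_num)⟩, ?_, fun b hb x hx => ?_⟩
  · exact div_pos (by linarith) (by positivity)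
  · have hb0 : 0 < b := hb.1
    have h1 : (Real.pi + κ) / 2 < annulusForce b b 0 / b :=
      hc ⟨hb.1, hb.2.trans_le (min_le_left _ _)⟩
    have h2 : annulusForce b b 0 / b ≤ annulusForce b b x / b + 3 * x * Real.pi := by
      rw [div_le_iff₀ hb0, add_mul, div_mul_cancel₀ _ hb0.ne']
      linarith [annulusForce_zero_le hb0.le hx.1.le]
    have h3 : annulusForce b 1 x ≤ κ := annulusForce_one_le hx.1.le
    have h4 := hx.2
    rw [lt_div_iff₀ (by positivity)] at h4
    linarith

/-! ### The two families of densities are admissible -/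

lemma admissibleDensity_Ioo {X : ℝ} (hX : 0 < X) {f : ℝ → ℝ} (hf : IntegrableOn f (Ioo 0 X))
    (hpos : ∀ x ∈ Ioo 0 X, 0 < f x) : AdmissibleDensity (Ioo 0 X) f := by
  have hle : ∀ t : ℝ, 0 < t → ∀ x ∈ Ioo 0 X, f x * Real.exp (-t * x) ≤ f x := fun t ht x hx =>
    mul_le_of_le_one_right (hpos x hx).le (Real.exp_le_one_iff.2 (by nlinarith [hx.1]))
  have hint : ∀ t : ℝ, 0 < t → IntegrableOn (fun x => f x * Real.exp (-t * x)) (Ioo 0 X) := by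
    intro t ht
    refine Integrable.mono' hf (hf.aestronglyMeasurable.mul
      (Measurable.aestronglyMeasurable (by fun_prop)))
      ((ae_restrict_mem measurableSet_Ioo).mono fun x hx => ?_)
    rw [Real.norm_of_nonneg (mul_nonneg (hpos x hx).le (Real.exp_pos _).le)]
    exact hle t ht x hx
  -- The transform is bounded by `∫ f`, so the exponent `γ = 1/2` is a convenient choice; the factor
  -- `2^(3/2)` makes `2^(3/2) t^(-3/2) ≥ 1` on `(0, 2]`.
  refine ⟨measurableSet_Ioo, fun x hx => hx.1, by simp [hX], hf.aestronglyMeasurable.aemeasurable,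
    hpos, hint, (∫ x in Ioo 0 X, f x) * (2 : ℝ) ^ (3 / 2 : ℝ), 1 / 2, by norm_num, by norm_num,
    fun t ht ht2 => ?_⟩
  have hI : 0 ≤ ∫ x in Ioo 0 X, f x :=
    setIntegral_nonneg measurableSet_Ioo fun x hx => (hpos x hx).le
  refine (setIntegral_mono_on (hint t ht) hf measurableSet_Ioo (hle t ht)).trans ?_
  rw [mul_assoc]
  refine le_mul_of_one_le_right hI ?_
  rw [show (1 / 2 - 2 : ℝ) = -(3 / 2) by norm_num, Real.rpow_neg ht.le, ← div_eq_mul_inv,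
    one_le_div (by positivity)]
  gcongr

lemma admissibleDensity_Ioi {X : ℝ} (hX : 1 ≤ X) {f : ℝ → ℝ} {C γ : ℝ} (hγ : 0 < γ)
    (hf : AEMeasurable f (volume.restrict (Ioi X))) (hpos : ∀ x ∈ Ioi X, 0 < f x)
    (hle : ∀ x ∈ Ioi X, f x ≤ C * x ^ (1 - γ)) : AdmissibleDensity (Ioi X) f := by
  have hX0 : 0 < X := by linarith
  have hsub : Ioi X ⊆ Ioi (0 : ℝ) := Ioi_subset_Ioi hX0.le
  have hC : 0 ≤ C := by
    have hmem : X + 1 ∈ Ioi X := by simp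
    have h1 := (hpos _ hmem).trans_le (hle _ hmem)
    exact (pos_of_mul_pos_left h1 (Real.rpow_nonneg (by linarith) _)).le
  -- Admissibility asks for an exponent below 1. Lowering `γ` to `δ` only weakens the growth bound,
  -- since `x ≥ 1`; the Gamma integral then gives `t^(δ-2)`.
  set δ := min γ (1 / 2) with hδ
  have hδ0 : 0 < δ := by positivity
  have hδ1 : δ < 1 := (min_le_right _ _).trans_lt (by norm_num)
  have hint0 : ∀ t : ℝ, 0 < t →
      IntegrableOn (fun x : ℝ => C * (x ^ (2 - δ - 1) * Real.exp (-(t * x)))) (Ioi 0) := by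
    intro t ht
    have := integrableOn_rpow_mul_exp_neg_mul_rpow (s := 2 - δ - 1) (p := 1) (by linarith)
      one_pos ht
    simpa [IntegrableOn] using this.const_mul C
  have hbd : ∀ t : ℝ, ∀ x ∈ Ioi X,
      f x * Real.exp (-t * x) ≤ C * (x ^ (2 - δ - 1) * Real.exp (-(t * x))) := by
    intro t x hx
    rw [← mul_assoc, neg_mul]
    refine mul_le_mul_of_nonneg_right ((hle x hx).trans ?_) (Real.exp_pos _).le
    refine mul_le_mul_of_nonneg_left (Real.rpow_le_rpow_of_exponent_le (hX.trans hx.le) ?_) hC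
    linarith [min_le_left γ (1 / 2)]
  have hint : ∀ t : ℝ, 0 < t → IntegrableOn (fun x => f x * Real.exp (-t * x)) (Ioi X) := by
    intro t ht
    refine Integrable.mono' ((hint0 t ht).mono_set hsub) (hf.aestronglyMeasurable.mul
      (Measurable.aestronglyMeasurable (by fun_prop)))
      ((ae_restrict_mem measurableSet_Ioi).mono fun x hx => ?_)
    rw [Real.norm_of_nonneg (mul_nonneg (hpos x hx).le (Real.exp_pos _).le)]
    exact hbd t x hx
  refine ⟨measurableSet_Ioi, hsub, by simp, hf, hpos, hint, C * Real.Gamma (2 - δ), δ, hδ0, hδ1,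
    fun t ht _ => ?_⟩
  calc ∫ x in Ioi X, f x * Real.exp (-t * x)
      ≤ ∫ x in Ioi X, C * (x ^ (2 - δ - 1) * Real.exp (-(t * x))) :=
        setIntegral_mono_on (hint t ht) ((hint0 t ht).mono_set hsub) measurableSet_Ioi (hbd t)
    _ ≤ ∫ x in Ioi 0, C * (x ^ (2 - δ - 1) * Real.exp (-(t * x))) := by
        refine setIntegral_mono_set (hint0 t ht)
          ((ae_restrict_mem measurableSet_Ioi).mono fun x hx => ?_) (LE.le.eventuallyLE hsub)
        have hx0 : 0 < x := hx
        simp only [Pi.zero_apply]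
        positivity
    _ = C * Real.Gamma (2 - δ) * t ^ (δ - 2) := by
        rw [integral_const_mul, Real.integral_rpow_mul_exp_neg_mul_Ioi (by linarith) ht, one_div,
          Real.inv_rpow ht.le, ← Real.rpow_neg ht.le, neg_sub]
        ring

/-! ### Assembly -/

theorem mainTheorem9 :
    (∃ b_star x_star : ℝ, b_star ∈ Ioo (0 : ℝ) 1 ∧ 0 < x_star ∧
      ∀ (f : ℝ → ℝ) (C₀ : ℝ),
        IntegrableOn f (Ioo 0 x_star) volume →
        (∀ x ∈ Ioo 0 x_star, 0 < f x) →
        IsRepresentingMeasure (densityKernel (Ioo 0 x_star) f C₀)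
            (densityMeasure (Ioo 0 x_star) f) ∧
          AssumptionA1 (densityKernel (Ioo 0 x_star) f C₀) ∧
          AssumptionA2 (densityKernel (Ioo 0 x_star) f C₀) ∧
          ∀ b ∈ Ioo (0 : ℝ) b_star, ∀ θ : ℝ,
            V1 (convolutionKernel (densityKernel (Ioo 0 x_star) f C₀)) b 0 0 θ
                < V2 (convolutionKernel (densityKernel (Ioo 0 x_star) f C₀)) b 0 0 θ ∧
              V2 (convolutionKernel (densityKernel (Ioo 0 x_star) f C₀)) b 0 0 θ < 0) ∧
    (∀ b ∈ Ioo (0 : ℝ) 1, ∃ x_star : ℝ, 0 < x_star ∧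
      ∀ (f : ℝ → ℝ) (C γ C₀ : ℝ), 0 < γ →
        AEMeasurable f (volume.restrict (Ioi x_star)) →
        (∀ x ∈ Ioi x_star, 0 < f x) →
        (∀ x ∈ Ioi x_star, f x ≤ C * x ^ (1 - γ)) →
        IsRepresentingMeasure (densityKernel (Ioi x_star) f C₀)
            (densityMeasure (Ioi x_star) f) ∧
          AssumptionA1 (densityKernel (Ioi x_star) f C₀) ∧
          AssumptionA2 (densityKernel (Ioi x_star) f C₀) ∧
          ∀ θ : ℝ,
            V2 (convolutionKernel (densityKernel (Ioi x_star) f C₀)) b 0 0 θ < 0 ∧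
              0 < V1 (convolutionKernel (densityKernel (Ioi x_star) f C₀)) b 0 0 θ) := by
  refine ⟨?_, fun b hb => ?_⟩
  · obtain ⟨b_star, x_star, hb_star, hx_star, hlt⟩ := exists_annulusForce_lt
    refine ⟨b_star, x_star, hb_star, hx_star, fun f C₀ hf hpos => ?_⟩
    have h := admissibleDensity_Ioo hx_star hf hpos
    refine ⟨h.isRepresentingMeasure C₀, h.assumptionA1 C₀, h.assumptionA2 C₀, fun b hb θ => ?_⟩
    have hb' : b ∈ Ioo (0 : ℝ) 1 := ⟨hb.1, hb.2.trans hb_star.2⟩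
    have hi1 := h.integrableOn_mul_annulusForce b hb'.1.le hb'.2.le
    have hi2 := h.integrableOn_mul_annulusForce b zero_le_one le_rfl
    have hi1' : IntegrableOn (fun x => f x * (annulusForce b b x / b)) (Ioo 0 x_star) := by
      simpa only [IntegrableOn, ← mul_div_assoc] using hi1.div_const b
    rw [h.V1_densityKernel C₀ hb', h.V2_densityKernel C₀ hb']
    refine ⟨neg_lt_neg (sub_pos.1 ?_), neg_lt_zero.2 ?_⟩
    · rw [← integral_sub hi1' hi2]
      refine h.setIntegral_pos (fun x hx => ?_) (hi1'.sub hi2)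
      rw [← mul_sub]
      exact mul_pos (hpos x hx) (sub_pos.2 (hlt b hb x hx))
    · exact h.setIntegral_pos
        (fun x hx => mul_pos (hpos x hx) (annulusForce_one_pos hb' hx.1.le)) hi2
  · obtain ⟨X, hX0, hneg⟩ := exists_annulusForce_neg hb
    -- Beyond `X` the inner force is negative; the 1 serves the comparison of powers in
    -- `admissibleDensity_Ioi`.
    refine ⟨max X 1, lt_max_of_lt_left hX0, fun f C γ C₀ hγ hf hpos hle => ?_⟩
    have h := admissibleDensity_Ioi (le_max_right X 1) hγ hf hpos hle
    refine ⟨h.isRepresentingMeasure C₀, h.assumptionA1 C₀, h.assumptionA2 C₀, fun θ => ?_⟩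
    have hi1 := h.integrableOn_mul_annulusForce b hb.1.le hb.2.le
    have hi2 := h.integrableOn_mul_annulusForce b zero_le_one le_rfl
    rw [h.V1_densityKernel C₀ hb, h.V2_densityKernel C₀ hb]
    refine ⟨neg_lt_zero.2 (h.setIntegral_pos (fun x hx => mul_pos (hpos x hx)
      (annulusForce_one_pos hb (h.subset_Ioi hx).le)) hi2), ?_⟩
    rw [← integral_neg]
    refine h.setIntegral_pos (fun x hx => ?_) ?_
    · have h1 := div_neg_of_neg_of_pos (hneg x ((le_max_left X 1).trans_lt hx)) hb.1
      exact neg_pos.2 (mul_neg_of_pos_of_neg (hpos x hx) h1)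
    · simp only [← mul_div_assoc]
      exact (hi1.div_const b).neg
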